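/- Let $r\ge 1$ and let $(G_k)_{k\ge 0}$ be a sequence of connected simple undirected graphs, $G_k$ having $n=n_k$ vertices $1,\dots,n$, where $n_k\to\infty$ (for instance $n_k=k+1$). Let $L=D-A$ be the Laplacian of $G_k$ and $0=\lambda_0\le\lambda_1\le\dots\le\lambda_{n-1}$ its eigenvalues. Assume that the geometry assumption holds with parameter $r$: there are $i_0\in\mathbb N$, $\kappa\in(0,1]$ and $C_1,C_2>0$, not depending on $k$, such that for all large $k$ $$C_1\Big(\frac in\Big)^{2/r}\le\lambda_i\le C_2\Big(\frac in\Big)^{2/r}\qquad\text{for all indices } i\in\{0,\dots,n-1\}\text{ with } i_0\le i\le\kappa n .$$ Put $\langle f,g\rangle_n=\frac1n\sum_{i=1}^n f(i)g(i)$, $\|f\|_n^2=\langle f,f\rangle_n$, and for $\beta,Q>0$ let $$H^\beta(Q)=\big\{f:\{1,\dots,n\}\to\mathbb R:\ \langle f,(I+(n^{2/r}L)^\beta)f\rangle_n\le Q^2\big\}.$$ Fix $\sigma>0$ and observe $Y_i=f(i)+\sigma\xi_i$, $i=1,\dots,n$, with $\xi_i$ independent standard Gaussians; write $\mathbb E_f$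 for the expectation when $f$ is the true function. Write $a_k\asymp b_k$ if $0<\liminf a_k/b_k\le\limsup a_k/b_k<\infty$. Then for all $\beta,Q>0$, as $k\to\infty$, $$\inf_{\hat f}\ \sup_{f\in H^\beta(Q)}\mathbb E_f\|\hat f-f\|_n^2\ \asymp\ n^{-2\beta/(2\beta+r)},$$ where the infimum is over all estimators $\hat f=\hat f(Y_1,\dots,Y_n)$. Moreover, the order is attained by a linear estimator of Pinsker type (which depends on $\beta$, $Q$, $\sigma$ and $r$): put $a_j=\big(1+(n^{2/r}\lambda_j)^\beta\big)^{1/2}$ and $\varepsilon=\sigma/\sqrt n$. For every $k$ there is a unique $x>0$ with $$\frac{\varepsilon^2}{x}\sum_{j=0}^{n-1}a_j(1-xa_j)_+=Q^2,$$ and, for any basis $\psi_0,\dots,\psi_{n-1}$ of eigenfunctions of $L$ with $L\psi_j=\lambda_j\psi_j$ that is orthonormal for $\langle\cdot,\cdot\rangle_n$, the estimator $\tilde f=\sum_{j=0}^{n-1}(1-xa_j)_+\langle Y,\psi_j\rangle_n\,\psi_j$ satisfies $$\sup_{f\in H^\beta(Q)}\mathbb E_f\|\tilde f-f\|_n^2\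 \asymp\ n^{-2\beta/(2\beta+r)}.$$ -/

import Mathlib

open MeasureTheory ProbabilityTheory Filter Topology
open scoped ENNReal

noncomputable section

namespace GraphRegression

/-- The Laplacian `L = D - A` of a simple graph on `n` vertices. -/
def laplacian {n : ℕ} (G : SimpleGraph (Fin n)) : Matrix (Fin n) (Fin n) ℝ :=
  open Classical in G.lapMatrix ℝ

theorem isHermitian_laplacian {n : ℕ} (G : SimpleGraph (Fin n)) : (laplacian G).IsHermitian := by
  classical
  exact G.isHermitian_lapMatrix (R := ℝ)

/-- The Laplacian eigenvalues, counted with multiplicity and in increasing order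
`λ 0 ≤ λ 1 ≤ … ≤ λ (n - 1)`.  Mathlib's `eigenvalues₀` lists them in decreasing order,
hence the reversal of the index. -/
def lapEigenvalue {n : ℕ} (G : SimpleGraph (Fin n)) (i : Fin n) : ℝ :=
  (isHermitian_laplacian G).eigenvalues₀ (Fin.cast (Fintype.card_fin n).symm i.rev)

/-- The normalised inner product `⟨f, g⟩ₙ = n⁻¹ ∑ i, f i * g i`. -/
def innerN {n : ℕ} (f g : Fin n → ℝ) : ℝ := (1 / (n : ℝ)) * ∑ i, f i * g i

/-- The squared norm `‖f‖ₙ² = n⁻¹ ∑ i, f i ^ 2`. -/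
def normSqN {n : ℕ} (f : Fin n → ℝ) : ℝ := (1 / (n : ℝ)) * ∑ i, f i ^ 2

/-- The geometry assumption with parameter `r`, for a sequence of graphs `G k` with `n k`
vertices: for suitable `i₀`, `κ ∈ (0, 1]` and `C₁, C₂ > 0` not depending on `k`,
for all large `k` the eigenvalues of `G k` with index `i₀ ≤ i ≤ κ n` are between
`C₁ (i / n) ^ (2 / r)` and `C₂ (i / n) ^ (2 / r)`, where `n = n k`. -/
def GeometryAssumption (n : ℕ → ℕ) (G : ∀ k, SimpleGraph (Fin (n k))) (r : ℝ) : Prop :=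
  ∃ (i₀ : ℕ) (κ C₁ C₂ : ℝ), 0 < κ ∧ κ ≤ 1 ∧ 0 < C₁ ∧ 0 < C₂ ∧
    ∀ᶠ k in atTop, ∀ i : Fin (n k), i₀ ≤ (i : ℕ) → ((i : ℕ) : ℝ) ≤ κ * (n k : ℝ) →
      C₁ * (((i : ℕ) : ℝ) / (n k : ℝ)) ^ (2 / r) ≤ lapEigenvalue (G k) i ∧
      lapEigenvalue (G k) i ≤ C₂ * (((i : ℕ) : ℝ) / (n k : ℝ)) ^ (2 / r)

/-- The matrix `(n ^ (2 / r) L) ^ β`; the power of the positive semidefinite matrix is taken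
in the functional calculus of symmetric matrices. -/
def lapPower {n : ℕ} (G : SimpleGraph (Fin n)) (r β : ℝ) : Matrix (Fin n) (Fin n) ℝ :=
  cfc (fun t : ℝ => t ^ β) (((n : ℝ) ^ (2 / r)) • laplacian G)

/-- The Sobolev-type ball `H^β(Q) = {f : ⟨f, (I + (n ^ (2 / r) L) ^ β) f⟩ₙ ≤ Q ^ 2}`. -/
def sobolevBall {n : ℕ} (G : SimpleGraph (Fin n)) (r β Q : ℝ) : Set (Fin n → ℝ) :=
  {f | innerN f (Matrix.mulVec (1 + lapPower G r β) f) ≤ Q ^ 2}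

/-- The law of the observations `Y i = f i + σ ξ i`, with `ξ i` independent standard Gaussians. -/
def obsLaw {n : ℕ} (σ : ℝ) (f : Fin n → ℝ) : Measure (Fin n → ℝ) :=
  (Measure.pi fun _ : Fin n => gaussianReal 0 1).map fun ξ i => f i + σ * ξ i

/-- The risk `E_f ‖fhat - f‖ₙ²` of the estimator `fhat = fhat(Y)`, with values in `[0, ∞]`. -/
def risk {n : ℕ} (σ : ℝ) (fhat : (Fin n → ℝ) → Fin n → ℝ) (f : Fin n → ℝ) : ℝ≥0∞ :=
  ∫⁻ y, ENNReal.ofReal (normSqN (fhat y - f)) ∂(obsLaw σ f)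

/-- The maximal risk of an estimator over the Sobolev-type ball `H^β(Q)`. -/
def maxRisk {n : ℕ} (G : SimpleGraph (Fin n)) (r β Q σ : ℝ)
    (fhat : (Fin n → ℝ) → Fin n → ℝ) : ℝ≥0∞ :=
  ⨆ f ∈ sobolevBall G r β Q, risk σ fhat f

/-- The minimax risk over `H^β(Q)`; an estimator is a measurable function of the data. -/
def minimaxRisk {n : ℕ} (G : SimpleGraph (Fin n)) (r β Q σ : ℝ) : ℝ≥0∞ :=
  ⨅ (fhat : (Fin n → ℝ) → Fin n → ℝ) (_ : Measurable fhat), maxRisk G r β Q σ fhat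

/-- `a ≍ b`, that is, `0 < liminf a / b ≤ limsup a / b < ∞`. -/
def SameOrder (a b : ℕ → ℝ≥0∞) : Prop :=
  0 < liminf (fun k => a k / b k) atTop ∧
    liminf (fun k => a k / b k) atTop ≤ limsup (fun k => a k / b k) atTop ∧
    limsup (fun k => a k / b k) atTop < ∞

/-- The rate `n ^ (-2 β / (2 β + r))`. -/
def rate (n : ℕ) (r β : ℝ) : ℝ≥0∞ := ENNReal.ofReal ((n : ℝ) ^ (-(2 * β) / (2 * β + r)))

/-- `ψ` is a family of Laplacian eigenfunctions for `λ 0 ≤ … ≤ λ (n - 1)`, orthonormal with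
respect to `⟨·, ·⟩ₙ`. -/
def IsEigenbasis {n : ℕ} (G : SimpleGraph (Fin n)) (ψ : Fin n → Fin n → ℝ) : Prop :=
  (∀ i j, innerN (ψ i) (ψ j) = if i = j then 1 else 0) ∧
    ∀ j, Matrix.mulVec (laplacian G) (ψ j) = lapEigenvalue G j • ψ j

/-- The semi-axis coefficients of `H^β(Q)` in a Laplacian eigenbasis:
`a j = (1 + (n ^ (2 / r) λ j) ^ β) ^ (1 / 2)`. -/
def axisCoeff {n : ℕ} (G : SimpleGraph (Fin n)) (r β : ℝ) (j : Fin n) : ℝ :=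
  Real.sqrt (1 + ((n : ℝ) ^ (2 / r) * lapEigenvalue G j) ^ β)

/-- `x > 0` solves Pinsker's equation `(ε ^ 2 / x) ∑ j, a j (1 - x a j)₊ = Q ^ 2` for the
ellipsoid `∑ j, a j ^ 2 f j ^ 2 ≤ Q ^ 2` at noise level `ε = σ / √n`. -/
def IsPinskerLevel {n : ℕ} (G : SimpleGraph (Fin n)) (r β Q σ x : ℝ) : Prop :=
  0 < x ∧
    (σ / Real.sqrt n) ^ 2 / x * ∑ j, axisCoeff G r β j * max (1 - x * axisCoeff G r β j) 0 = Q ^ 2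

/-- The linear estimator `∑ j, (1 - x a j)₊ ⟨Y, ψ j⟩ₙ ψ j`. -/
def pinskerEstimator {n : ℕ} (G : SimpleGraph (Fin n)) (r β x : ℝ) (ψ : Fin n → Fin n → ℝ)
    (y : Fin n → ℝ) : Fin n → ℝ :=
  ∑ j, (max (1 - x * axisCoeff G r β j) 0 * innerN y (ψ j)) • ψ j

end GraphRegression

end

/-!
In the coordinates `f j = ⟨f, ψ j⟩ₙ` of an orthonormal Laplacian eigenbasis, the Sobolev ball is the
ellipsoid `∑ j, a j ^ 2 * f j ^ 2 ≤ Q ^ 2` (`IsEigenbasis.mem_sobolevBall_iff`) and the coordinates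
of the data have noise variance `ε ^ 2 = σ ^ 2 / n`. The geometry assumption says that
`a j` is of order `j ^ (β / r)` for `i₀ ≤ j ≤ κ n`; monotonicity of the eigenvalues extends the
lower estimate to all `j ≥ i₀`, so at most `K * T ^ (r / β)` coefficients are below `T`
(`axisCount_le`). Both bounds come from balancing at the frequency `n ^ (r / (2 β + r))`.

Upper bound. At the Pinsker level `x` the bias bound `x ^ 2 * Q ^ 2` and the variance combine, by
Pinsker's equation, to `ε ^ 2 ∑ j, (1 - x a j)₊`. Splitting this sum at `a j ≤ T` bounds it by
`ε ^ 2 * #{a j ≤ T} + x * Q ^ 2 / T` (`maxRisk_pinskerEstimator_le`). Pinsker's equation also gives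
`x ^ 2 * Q ^ 2 ≤ ε ^ 2 * #{a j ≤ 1 / x}`, hence `x ≲ n ^ (-β / (2 β + r))`, and
`T = n ^ (β / (2 β + r))` yields the rate. The level is unique because the left-hand side of
the equation is strictly increasing in `1 / x` where it is positive (`existsUnique_pinsker_level`).

Lower bound. The signals with coefficients `± δ`, `δ ^ 2` of order `1 / n`, at the frequencies
`i₀ ≤ j ≤ n ^ (r / (2 β + r))` lie in the ball, and neighbouring ones have laws of Hellinger affinity
at least `1 / 2`. The two-point bound (`two_point_bound`), averaged over the hypercube of signs
(`card_mul_le_maxRisk`), shows that each of these frequencies costs a risk of order `δ ^ 2`.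
-/

namespace GraphRegression

/-! ### Spectral coordinates of the Sobolev ball -/

theorem lapEigenvalue_monotone {n : ℕ} (G : SimpleGraph (Fin n)) : Monotone (lapEigenvalue G) := by
  intro i j hij
  apply (isHermitian_laplacian G).eigenvalues₀_antitone
  simpa [Fin.le_def] using Fin.rev_le_rev.mpr hij

/-- The bijection of `Fin n` matching the increasing enumeration of the Laplacian eigenvalues
with Mathlib's unordered one. -/
noncomputable def eigenIndex (n : ℕ) : Fin n ≃ Fin n :=
  (Fin.revPerm.trans (finCongr (Fintype.card_fin n).symm)).trans
    (Fintype.equivOfCardEq (Fintype.card_fin _))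

theorem lapEigenvalue_eq_eigenvalues {n : ℕ} (G : SimpleGraph (Fin n)) (j : Fin n) :
    lapEigenvalue G j = (isHermitian_laplacian G).eigenvalues (eigenIndex n j) := by
  simp [lapEigenvalue, Matrix.IsHermitian.eigenvalues, eigenIndex]

theorem lapEigenvalue_nonneg {n : ℕ} (G : SimpleGraph (Fin n)) (j : Fin n) :
    0 ≤ lapEigenvalue G j := by
  classical
  rw [lapEigenvalue_eq_eigenvalues]
  refine Matrix.PosSemidef.eigenvalues_nonneg (A := laplacian G) ?_ _
  exact SimpleGraph.posSemidef_lapMatrix ℝ G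

theorem exists_isEigenbasis {n : ℕ} (hn : 0 < n) (G : SimpleGraph (Fin n)) :
    ∃ ψ : Fin n → Fin n → ℝ, IsEigenbasis G ψ := by
  have hn' : (n : ℝ) ≠ 0 := by positivity
  set b := (isHermitian_laplacian G).eigenvectorBasis
  refine ⟨fun j => Real.sqrt n • ⇑(b (eigenIndex n j)), fun i j => ?_, fun j => ?_⟩
  · have h := b.inner_eq_ite (eigenIndex n i) (eigenIndex n j)
    simp only [(eigenIndex n).injective.eq_iff] at h
    rw [← h, PiLp.inner_apply, innerN, Finset.mul_sum]
    refine Finset.sum_congr rfl fun l _ => ?_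
    have hs : Real.sqrt n * Real.sqrt n = n := Real.mul_self_sqrt (by positivity)
    simp only [Pi.smul_apply, smul_eq_mul, RCLike.inner_apply, conj_trivial]
    calc _ = 1 / (n : ℝ) * (Real.sqrt n * Real.sqrt n) *
          (b (eigenIndex n j) l * b (eigenIndex n i) l) := by ring
      _ = _ := by rw [hs]; field_simp
  · rw [Matrix.mulVec_smul, lapEigenvalue_eq_eigenvalues,
      Matrix.IsHermitian.mulVec_eigenvectorBasis, smul_comm]

theorem innerN_eq_dotProduct {n : ℕ} (f g : Fin n → ℝ) :
    innerN f g = (1 / (n : ℝ)) * dotProduct f g := rfl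

theorem innerN_comm {n : ℕ} (f g : Fin n → ℝ) : innerN f g = innerN g f := by
  simp [innerN, mul_comm]

theorem innerN_sub_left {n : ℕ} (f g h : Fin n → ℝ) :
    innerN (f - g) h = innerN f h - innerN g h := by
  simp [innerN_eq_dotProduct, mul_sub]

theorem innerN_smul_left {n : ℕ} (c : ℝ) (f h : Fin n → ℝ) :
    innerN (c • f) h = c * innerN f h := by
  simp [innerN_eq_dotProduct]; ring

theorem innerN_sum_left {n : ℕ} {ι : Type*} (s : Finset ι) (f : ι → Fin n → ℝ) (h : Fin n → ℝ) :
    innerN (∑ i ∈ s, f i) h = ∑ i ∈ s, innerN (f i) h := by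
  simp [innerN_eq_dotProduct, sum_dotProduct, Finset.mul_sum]

theorem normSqN_eq_innerN {n : ℕ} (f : Fin n → ℝ) : normSqN f = innerN f f := by
  simp [normSqN, innerN, sq]

namespace IsEigenbasis

variable {n : ℕ} {G : SimpleGraph (Fin n)} {ψ : Fin n → Fin n → ℝ}

theorem innerN_sum_smul (h : IsEigenbasis G ψ) (c : Fin n → ℝ) (i : Fin n) :
    innerN (∑ j, c j • ψ j) (ψ i) = c i := by
  simp [innerN_sum_left, innerN_smul_left, h.1]

/-- Every function is the sum of its Fourier series: a family of `n` orthonormal vectors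
in dimension `n` is complete. -/
theorem sum_innerN_smul (h : IsEigenbasis G ψ) (v : Fin n → ℝ) :
    ∑ j, innerN v (ψ j) • ψ j = v := by
  rcases Nat.eq_zero_or_pos n with rfl | hn
  · exact Subsingleton.elim _ _
  have hn' : (n : ℝ) ≠ 0 := by positivity
  let M : Matrix (Fin n) (Fin n) ℝ := Matrix.of ψ
  have h1 : ((1 / (n : ℝ)) • M) * M.transpose = 1 := by
    ext i j
    have := h.1 i j
    rw [innerN, Finset.mul_sum] at this
    simp only [Matrix.smul_apply, Matrix.mul_apply, Matrix.transpose_apply, M,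
      Matrix.of_apply, smul_eq_mul, Matrix.one_apply, ← this, mul_assoc]
  have h2 := mul_eq_one_comm.mp h1
  have h3 := congrArg (fun A => A.mulVec v) h2
  simp only [Matrix.one_mulVec, ← Matrix.mulVec_mulVec] at h3
  conv_rhs => rw [← h3]
  ext l
  simp only [Finset.sum_apply, Pi.smul_apply, smul_eq_mul, innerN, Matrix.mulVec, dotProduct,
    Matrix.transpose_apply, M, Matrix.of_apply, Matrix.smul_apply]
  refine Finset.sum_congr rfl fun i _ => ?_
  rw [mul_comm, Finset.mul_sum]
  exact congrArg _ (Finset.sum_congr rfl fun j _ => by ring)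

/-- Parseval's identity. -/
theorem innerN_eq_sum (h : IsEigenbasis G ψ) (v w : Fin n → ℝ) :
    innerN v w = ∑ j, innerN v (ψ j) * innerN w (ψ j) := by
  conv_lhs => rw [← h.sum_innerN_smul v]
  simp [innerN_sum_left, innerN_smul_left, innerN_comm w]

theorem normSqN_eq_sum (h : IsEigenbasis G ψ) (v : Fin n → ℝ) :
    normSqN v = ∑ j, innerN v (ψ j) ^ 2 := by
  rw [normSqN_eq_innerN, h.innerN_eq_sum]
  simp [sq]

end IsEigenbasis

/-- The functional calculus of a Hermitian matrix acts on an eigenvector through its eigenvalue. -/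
theorem cfc_mulVec_of_mulVec_eq_smul {ι : Type*} [Fintype ι] [DecidableEq ι] {A : Matrix ι ι ℝ}
    (hA : A.IsHermitian) (f : ℝ → ℝ) {v : ι → ℝ} {μ : ℝ} (hv : A.mulVec v = μ • v) :
    (cfc f A).mulVec v = f μ • v := by
  set U : Matrix ι ι ℝ := (hA.eigenvectorUnitary : Matrix ι ι ℝ)
  have hUU : U * star U = 1 := Unitary.coe_mul_star_self _
  have hUU' : star U * U = 1 := Unitary.coe_star_mul_self _
  set w := (star U).mulVec v with hw
  have hvw : v = U.mulVec w := by rw [hw, Matrix.mulVec_mulVec, hUU, Matrix.one_mulVec]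
  have hspec : A = U * Matrix.diagonal hA.eigenvalues * star U := by
    conv_lhs => rw [hA.spectral_theorem, Unitary.conjStarAlgAut_apply]
    rfl
  have hcfc : cfc f A = U * Matrix.diagonal (f ∘ hA.eigenvalues) * star U := by
    rw [hA.cfc_eq, Matrix.IsHermitian.cfc, Unitary.conjStarAlgAut_apply]
    rfl
  have hDw : (Matrix.diagonal hA.eigenvalues).mulVec w = μ • w := by
    have h1 : (star U).mulVec (A.mulVec v) = μ • w := by rw [hv, Matrix.mulVec_smul]
    rw [← h1]
    conv_rhs => rw [hspec]
    rw [← Matrix.mulVec_mulVec, ← Matrix.mulVec_mulVec, Matrix.mulVec_mulVec _ (star U) U, hUU',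
      Matrix.one_mulVec]
  have hfw : (Matrix.diagonal (f ∘ hA.eigenvalues)).mulVec w = f μ • w := by
    ext i
    have hi := congrFun hDw i
    simp only [Matrix.mulVec_diagonal, Pi.smul_apply, smul_eq_mul, Function.comp] at hi ⊢
    rcases mul_eq_mul_right_iff.mp hi with h | h
    · rw [h]
    · simp [h]
  rw [hcfc, ← Matrix.mulVec_mulVec, ← Matrix.mulVec_mulVec, ← hw, hfw, Matrix.mulVec_smul, ← hvw]

section Sobolev

variable {n : ℕ} {G : SimpleGraph (Fin n)} {ψ : Fin n → Fin n → ℝ} {r β : ℝ}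

theorem axisCoeff_sq (G : SimpleGraph (Fin n)) (r β : ℝ) (j : Fin n) :
    axisCoeff G r β j ^ 2 = 1 + ((n : ℝ) ^ (2 / r) * lapEigenvalue G j) ^ β := by
  have := lapEigenvalue_nonneg G j
  rw [axisCoeff, Real.sq_sqrt (by positivity)]

theorem one_le_axisCoeff (G : SimpleGraph (Fin n)) (r β : ℝ) (j : Fin n) :
    1 ≤ axisCoeff G r β j := by
  have := lapEigenvalue_nonneg G j
  rw [axisCoeff, Real.one_le_sqrt]
  exact le_add_of_nonneg_right (by positivity)

theorem IsEigenbasis.mem_sobolevBall_iff (h : IsEigenbasis G ψ) (Q : ℝ) (f : Fin n → ℝ) :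
    f ∈ sobolevBall G r β Q ↔
      ∑ j, axisCoeff G r β j ^ 2 * innerN f (ψ j) ^ 2 ≤ Q ^ 2 := by
  have hA : (((n : ℝ) ^ (2 / r)) • laplacian G).IsHermitian := by
    have := isHermitian_laplacian G
    simp only [Matrix.IsHermitian, Matrix.conjTranspose_smul, star_trivial] at this ⊢
    rw [this]
  have key (j : Fin n) : (1 + lapPower G r β).mulVec (ψ j) = axisCoeff G r β j ^ 2 • ψ j := by
    have hev : (((n : ℝ) ^ (2 / r)) • laplacian G).mulVec (ψ j) =
        ((n : ℝ) ^ (2 / r) * lapEigenvalue G j) • ψ j := by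
      rw [Matrix.smul_mulVec, h.2, smul_smul]
    rw [Matrix.add_mulVec, Matrix.one_mulVec, lapPower, cfc_mulVec_of_mulVec_eq_smul hA _ hev,
      axisCoeff_sq, add_smul, one_smul]
  have hf : (1 + lapPower G r β).mulVec f =
      ∑ j, (axisCoeff G r β j ^ 2 * innerN f (ψ j)) • ψ j := by
    conv_lhs => rw [← h.sum_innerN_smul f]
    simp [Matrix.mulVec_sum, Matrix.mulVec_smul, key, smul_smul, mul_comm]
  rw [sobolevBall, Set.mem_ofPred_eq, hf, h.innerN_eq_sum]
  simp only [h.innerN_sum_smul]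
  rw [Finset.sum_congr rfl fun j _ => show _ = axisCoeff G r β j ^ 2 * innerN f (ψ j) ^ 2 by ring]

end Sobolev

/-! ### Gaussian observations -/

/-- The product over the coordinates of the densities `p i` is a density of the product measure. -/
theorem pi_withDensity_ofReal {ι : Type*} [Fintype ι] (p : ι → ℝ → ℝ) (hp0 : ∀ i x, 0 ≤ p i x)
    (hp : ∀ i, Integrable (p i)) [∀ i, SigmaFinite (volume.withDensity fun x => .ofReal (p i x))] :
    Measure.pi (fun i => (volume : Measure ℝ).withDensity fun x => .ofReal (p i x)) =
      volume.withDensity fun y : ι → ℝ => .ofReal (∏ i, p i (y i)) := by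
  refine Measure.pi_eq fun s hs => ?_
  have hint : Integrable (fun y : ι → ℝ => ∏ i, p i (y i))
      (Measure.pi fun i => (volume : Measure ℝ).restrict (s i)) :=
    Integrable.fintype_prod_dep fun i => (hp i).restrict
  rw [withDensity_apply _ (MeasurableSet.univ_pi hs), volume_pi, Measure.restrict_pi_pi,
    ← ofReal_integral_eq_lintegral_ofReal hint
      (ae_of_all _ fun y => Finset.prod_nonneg fun i _ => hp0 i (y i)),
    integral_fintype_prod_eq_prod,
    ENNReal.ofReal_prod_of_nonneg fun i _ => integral_nonneg (hp0 i)]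
  refine Finset.prod_congr rfl fun i _ => ?_
  rw [withDensity_apply _ (hs i),
    ofReal_integral_eq_lintegral_ofReal (hp i).restrict (ae_of_all _ (hp0 i))]

section Observations

variable {n : ℕ} {σ : ℝ}

/-- The Lebesgue density of the law `obsLaw σ f` of the observations. -/
noncomputable def obsDensity (σ : ℝ) (f y : Fin n → ℝ) : ℝ :=
  ∏ i, gaussianPDFReal (f i) (.mk (σ ^ 2) (sq_nonneg σ)) (y i)

theorem obsDensity_nonneg (f y : Fin n → ℝ) : 0 ≤ obsDensity σ f y :=
  Finset.prod_nonneg fun _ _ => gaussianPDFReal_nonneg _ _ _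

theorem measurable_obsDensity (f : Fin n → ℝ) : Measurable (obsDensity σ f) := by
  unfold obsDensity
  fun_prop

theorem obsLaw_eq_withDensity (hσ : 0 < σ) (f : Fin n → ℝ) :
    obsLaw σ f = volume.withDensity fun y => .ofReal (obsDensity σ f y) := by
  have hv : (NNReal.mk (σ ^ 2) (sq_nonneg σ)) ≠ 0 := by
    intro h
    have := congrArg NNReal.toReal h
    simp at this
    exact hσ.ne' this
  have hmap (i : Fin n) : (gaussianReal 0 1).map (fun x => f i + σ * x) =
      gaussianReal (f i) (.mk (σ ^ 2) (sq_nonneg σ)) := by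
    have : (fun x : ℝ => f i + σ * x) = (fun x => f i + x) ∘ (fun x => σ * x) := rfl
    rw [this, ← Measure.map_map (by fun_prop) (by fun_prop), gaussianReal_map_const_mul,
      gaussianReal_map_const_add]
    simp
  have hdens (i : Fin n) : gaussianReal (f i) (.mk (σ ^ 2) (sq_nonneg σ)) =
      volume.withDensity fun x => .ofReal
        (gaussianPDFReal (f i) (.mk (σ ^ 2) (sq_nonneg σ)) x) :=
    gaussianReal_of_var_ne_zero _ hv
  have (i : Fin n) : SigmaFinite ((volume : Measure ℝ).withDensity fun x => .ofReal
      (gaussianPDFReal (f i) (.mk (σ ^ 2) (sq_nonneg σ)) x)) := by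
    rw [← hdens]; infer_instance
  have (i : Fin n) : SigmaFinite ((gaussianReal 0 1).map (fun x => f i + σ * x)) := by
    rw [hmap]; infer_instance
  rw [obsLaw, Measure.pi_map_pi (f := fun i x => f i + σ * x) (fun i => by fun_prop)]
  simp only [hmap, hdens]
  exact pi_withDensity_ofReal _ (fun _ _ => gaussianPDFReal_nonneg _ _ _)
    (fun _ => integrable_gaussianPDFReal _ _)

instance (σ : ℝ) (f : Fin n → ℝ) : IsProbabilityMeasure (obsLaw σ f) :=
  Measure.isProbabilityMeasure_map
    (measurable_pi_lambda _ fun i => by fun_prop).aemeasurable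

theorem lintegral_obsDensity (hσ : 0 < σ) (f : Fin n → ℝ) :
    ∫⁻ y, .ofReal (obsDensity σ f y) = 1 := by
  have h := measure_univ (μ := obsLaw σ f)
  rwa [obsLaw_eq_withDensity hσ, withDensity_apply _ .univ, setLIntegral_univ] at h

theorem lintegral_obsLaw (hσ : 0 < σ) (f : Fin n → ℝ) {u : (Fin n → ℝ) → ℝ}
    (hu : Measurable u) :
    ∫⁻ y, .ofReal (u y) ∂(obsLaw σ f) = ∫⁻ y, .ofReal (obsDensity σ f y * u y) := by
  rw [obsLaw_eq_withDensity hσ, lintegral_withDensity_eq_lintegral_mul _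
    (measurable_obsDensity f).ennreal_ofReal hu.ennreal_ofReal]
  simp [ENNReal.ofReal_mul (obsDensity_nonneg f _)]

/-- The geometric mean of two Gaussian densities with the same variance is, up to a constant, the
density centred at the midpoint; the constant is the Hellinger affinity of the two laws. -/
theorem sqrt_obsDensity_mul (hσ : 0 < σ) (f g y : Fin n → ℝ) :
    Real.sqrt (obsDensity σ f y) * Real.sqrt (obsDensity σ g y) =
      Real.exp (-(∑ i, (f i - g i) ^ 2) / (8 * σ ^ 2)) *
        obsDensity σ (fun i => (f i + g i) / 2) y := by
  rw [← Real.sqrt_mul (obsDensity_nonneg f y), Real.sqrt_eq_iff_eq_sq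
    (mul_nonneg (obsDensity_nonneg f y) (obsDensity_nonneg g y))
    (mul_nonneg (Real.exp_nonneg _) (obsDensity_nonneg _ y)), mul_pow, ← Real.exp_nat_mul]
  have : ((2 : ℕ) : ℝ) * (-(∑ i, (f i - g i) ^ 2) / (8 * σ ^ 2)) =
      ∑ i, -(f i - g i) ^ 2 / (4 * σ ^ 2) := by
    rw [← Finset.sum_div, Finset.sum_neg_distrib]
    push_cast
    field_simp
    ring
  rw [this, Real.exp_sum]
  simp only [obsDensity, ← Finset.prod_mul_distrib, ← Finset.prod_pow]
  refine Finset.prod_congr rfl fun i _ => ?_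
  simp only [gaussianPDFReal, NNReal.coe_mk]
  rw [mul_mul_mul_comm, ← Real.exp_add, mul_pow, ← Real.exp_nat_mul, ← sq, mul_left_comm,
    ← Real.exp_add]
  congr 2
  push_cast
  field_simp
  ring

/-- **Two-point bound.** If the laws of the observations under `f₀` and `f₁` have Hellinger
affinity at least `1 / 2`, no function `g` of the data is close to `c₀` under `f₀` and to `c₁`
under `f₁`. -/
theorem two_point_bound (hσ : 0 < σ) (f₀ f₁ : Fin n → ℝ) {g : (Fin n → ℝ) → ℝ}
    (hg : Measurable g) (c₀ c₁ : ℝ)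
    (hA : 1 / 2 ≤ Real.exp (-(∑ i, (f₀ i - f₁ i) ^ 2) / (8 * σ ^ 2))) :
    ENNReal.ofReal ((c₀ - c₁) ^ 2 / 8) ≤
      ∫⁻ y, .ofReal ((g y - c₀) ^ 2) ∂(obsLaw σ f₀) +
        ∫⁻ y, .ofReal ((g y - c₁) ^ 2) ∂(obsLaw σ f₁) := by
  have hm (f : Fin n → ℝ) := measurable_obsDensity (σ := σ) f
  have hp (f y : Fin n → ℝ) := obsDensity_nonneg (σ := σ) f y
  set D := (c₀ - c₁) ^ 2
  have hD : 0 ≤ D := sq_nonneg _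
  set mid : Fin n → ℝ := fun i => (f₀ i + f₁ i) / 2
  -- Weighted AM-GM: with `a ^ 2`, `b ^ 2` the two densities, `(c₀ - c₁) a b` is the sum of
  -- `(g - c₁) a b` and `(c₀ - g) a b`.
  have hpt (y : Fin n → ℝ) : D / 4 * obsDensity σ mid y ≤
      (obsDensity σ f₀ y * (g y - c₀) ^ 2 + obsDensity σ f₁ y * (g y - c₁) ^ 2) +
        (D / 16 * obsDensity σ f₀ y + D / 16 * obsDensity σ f₁ y) := by
    have h0 := Real.sq_sqrt (hp f₀ y)
    have h1 := Real.sq_sqrt (hp f₁ y)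
    have hab := sqrt_obsDensity_mul hσ f₀ f₁ y
    set a := Real.sqrt (obsDensity σ f₀ y)
    set b := Real.sqrt (obsDensity σ f₁ y)
    have h2 : D / 4 * obsDensity σ mid y ≤ D / 2 * (a * b) := by
      rw [hab]
      have := mul_le_mul_of_nonneg_right hA (hp mid y)
      nlinarith
    refine h2.trans ?_
    rw [← h0, ← h1]
    simp only [D]
    nlinarith [sq_nonneg ((g y - c₁) * b - (c₀ - c₁) / 4 * a),
      sq_nonneg ((c₀ - g y) * a - (c₀ - c₁) / 4 * b)]
  have hint := lintegral_mono (μ := volume) fun y => ENNReal.ofReal_le_ofReal (hpt y)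
  have e1 (f : Fin n → ℝ) (c : ℝ) (hc : 0 ≤ c) :
      ∫⁻ y, .ofReal (c * obsDensity σ f y) = ENNReal.ofReal c := by
    simp_rw [ENNReal.ofReal_mul hc]
    rw [lintegral_const_mul _ (hm f).ennreal_ofReal, lintegral_obsDensity hσ, mul_one]
  rw [e1 _ _ (by positivity)] at hint
  have e2 : ∫⁻ y, .ofReal ((obsDensity σ f₀ y * (g y - c₀) ^ 2 +
      obsDensity σ f₁ y * (g y - c₁) ^ 2) +
        (D / 16 * obsDensity σ f₀ y + D / 16 * obsDensity σ f₁ y)) =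
      (∫⁻ y, .ofReal ((g y - c₀) ^ 2) ∂(obsLaw σ f₀) +
        ∫⁻ y, .ofReal ((g y - c₁) ^ 2) ∂(obsLaw σ f₁)) + ENNReal.ofReal (D / 8) := by
    rw [lintegral_obsLaw hσ _ (by fun_prop), lintegral_obsLaw hσ _ (by fun_prop),
      ← lintegral_add_left (by fun_prop)]
    have : ENNReal.ofReal (D / 8) = ENNReal.ofReal (D / 16) + ENNReal.ofReal (D / 16) := by
      rw [← ENNReal.ofReal_add (by positivity) (by positivity)]; congr 1; ring
    rw [this]
    nth_rw 1 [← e1 f₀ _ (by positivity)]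
    rw [← e1 f₁ (D / 16) (by positivity), ← lintegral_add_left (by fun_prop),
      ← lintegral_add_left (by fun_prop)]
    refine lintegral_congr fun y => ?_
    have := hp f₀ y
    have := hp f₁ y
    rw [ENNReal.ofReal_add (by positivity) (by positivity),
      ENNReal.ofReal_add (by positivity) (by positivity),
      ENNReal.ofReal_add (by positivity) (by positivity)]
  rw [e2] at hint
  have e3 : ENNReal.ofReal (D / 4) = ENNReal.ofReal (D / 8) + ENNReal.ofReal (D / 8) := by
    rw [← ENNReal.ofReal_add (by positivity) (by positivity)]; congr 1; ring
  rw [e3] at hint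
  exact (ENNReal.add_le_add_iff_right ENNReal.ofReal_ne_top).mp hint

/-- Bias-variance decomposition for an affine functional of the observations. -/
theorem lintegral_affine_sq (f w : Fin n → ℝ) (b : ℝ) :
    ∫⁻ y, .ofReal ((b + ∑ i, w i * (y i - f i)) ^ 2) ∂(obsLaw σ f) =
      ENNReal.ofReal (b ^ 2 + σ ^ 2 * ∑ i, w i ^ 2) := by
  rw [obsLaw, lintegral_map (by fun_prop) (by fun_prop)]
  set μ := Measure.pi fun _ : Fin n => gaussianReal 0 1
  set Z : (Fin n → ℝ) → ℝ := ∑ i, fun ξ => (σ * w i) * id (ξ i) with hZ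
  have hL (i : Fin n) : MemLp (fun x : ℝ => (σ * w i) * id x) 2 (gaussianReal 0 1) :=
    (memLp_id_gaussianReal 2).const_mul _
  have hLi (i : Fin n) : MemLp (fun ξ : Fin n → ℝ => (σ * w i) * id (ξ i)) 2 μ :=
    (hL i).comp_measurePreserving (measurePreserving_eval _ i)
  have hZL : MemLp Z 2 μ := memLp_finsetSum' _ fun i _ => hLi i
  have hmean : ∫ ξ, Z ξ ∂μ = 0 := by
    simp only [hZ, Finset.sum_apply]
    rw [integral_finsetSum _ fun i _ => (hLi i).integrable (by norm_num)]
    refine Finset.sum_eq_zero fun i _ => ?_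
    rw [integral_const_mul]
    have : ∫ ξ, id (ξ i) ∂μ = ∫ x, id x ∂(gaussianReal 0 1) :=
      integral_comp_eval (μ := fun _ : Fin n => gaussianReal 0 1) (f := id) (by fun_prop)
    rw [this]
    simp
  have hvar : Var[Z; μ] = σ ^ 2 * ∑ i, w i ^ 2 := by
    rw [hZ, variance_sum_pi (X := fun i x => (σ * w i) * id x) hL, Finset.mul_sum]
    refine Finset.sum_congr rfl fun i _ => ?_
    rw [variance_const_mul, variance_id_gaussianReal]
    simp [mul_pow]
  have hsq : ∫ ξ, Z ξ ^ 2 ∂μ = σ ^ 2 * ∑ i, w i ^ 2 := by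
    rw [← hvar, variance_eq_sub hZL, hmean]
    simp
  have hZi : Integrable Z μ := hZL.integrable (by norm_num)
  have hexp (ξ : Fin n → ℝ) : (b + ∑ i, w i * (f i + σ * ξ i - f i)) ^ 2 =
      b ^ 2 + 2 * b * Z ξ + Z ξ ^ 2 := by
    have : ∑ i, w i * (f i + σ * ξ i - f i) = Z ξ := by
      simp only [hZ, Finset.sum_apply, id]
      exact Finset.sum_congr rfl fun i _ => by ring
    rw [this]; ring
  simp only [hexp]
  have hi1 : Integrable (fun ξ => b ^ 2 + 2 * b * Z ξ) μ :=
    (integrable_const _).add (hZi.const_mul _)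
  have hi2 : Integrable (fun ξ => b ^ 2 + 2 * b * Z ξ + Z ξ ^ 2) μ := hi1.add hZL.integrable_sq
  rw [← ofReal_integral_eq_lintegral_ofReal hi2
    (ae_of_all _ fun ξ => by
      simp only [Pi.zero_apply, ← hexp]; positivity), integral_add hi1 hZL.integrable_sq,
    integral_add (integrable_const _) (hZi.const_mul _), integral_const_mul, hmean, hsq]
  simp

end Observations

/-! ### The Pinsker estimator -/

/-- In the variable `y = 1 / x`, the left-hand side of Pinsker's equation is a continuous
increasing function, strictly increasing where it is positive. -/
theorem existsUnique_pinsker_level {ι : Type*} [Fintype ι] [Nonempty ι] {a : ι → ℝ}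
    (ha : ∀ j, 0 < a j) {s K : ℝ} (hs : 0 < s) (hK : 0 < K) :
    ∃! x : ℝ, 0 < x ∧ s / x * ∑ j, a j * max (1 - x * a j) 0 = K := by
  set H : ℝ → ℝ := fun y => ∑ j, a j * max (y - a j) 0 with hH
  have hterm (j : ι) (y : ℝ) : 0 ≤ a j * max (y - a j) 0 :=
    mul_nonneg (ha j).le (le_max_right _ _)
  have hconv {x : ℝ} (hx : 0 < x) :
      s / x * ∑ j, a j * max (1 - x * a j) 0 = K ↔ H x⁻¹ = K / s := by
    have : s / x * ∑ j, a j * max (1 - x * a j) 0 = s * H x⁻¹ := by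
      simp only [hH, div_eq_mul_inv, mul_assoc, Finset.mul_sum]
      refine Finset.sum_congr rfl fun j _ => ?_
      have h1 : x⁻¹ - a j = x⁻¹ * (1 - x * a j) := by field_simp
      rw [h1, ← mul_zero x⁻¹, ← mul_max_of_nonneg _ _ (inv_nonneg.mpr hx.le), mul_zero]
      ring
    rw [this, eq_div_iff hs.ne', mul_comm]
  have hcont : Continuous H := by fun_prop
  have hstrict {y z : ℝ} (hyz : y < z) (hy : 0 < H y) : H y < H z := by
    obtain ⟨j, -, hj⟩ := Finset.exists_ne_zero_of_sum_ne_zero hy.ne'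
    have hj' : 0 < y - a j := by
      by_contra hcon
      exact hj (by rw [max_eq_right (not_lt.mp hcon), mul_zero])
    refine Finset.sum_lt_sum (fun i _ => ?_) ⟨j, Finset.mem_univ j, ?_⟩
    · exact mul_le_mul_of_nonneg_left (max_le_max_right _ (by linarith)) (ha i).le
    · refine mul_lt_mul_of_pos_left ?_ (ha j)
      rw [max_eq_left hj'.le, max_eq_left (by linarith)]
      linarith
  have hKs : 0 < K / s := div_pos hK hs
  have hH0 : H 0 = 0 := Finset.sum_eq_zero fun j _ => by
    rw [max_eq_right (by linarith [ha j]), mul_zero]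
  obtain ⟨j₀⟩ := ‹Nonempty ι›
  set Y := a j₀ + K / s / a j₀
  have hY0 : 0 ≤ Y := by have := ha j₀; positivity
  have hHY : K / s ≤ H Y := by
    have h1 : a j₀ * max (Y - a j₀) 0 ≤ H Y :=
      Finset.single_le_sum (fun j _ => hterm j Y) (Finset.mem_univ j₀)
    have h2 : K / s = a j₀ * (Y - a j₀) := by
      simp only [Y, add_sub_cancel_left]
      rw [mul_div_cancel₀ _ (ha j₀).ne']
    calc K / s = a j₀ * (Y - a j₀) := h2
      _ ≤ a j₀ * max (Y - a j₀) 0 := mul_le_mul_of_nonneg_left (le_max_left _ _) (ha j₀).le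
      _ ≤ H Y := h1
  obtain ⟨y, ⟨hy0, -⟩, hy⟩ := intermediate_value_Icc hY0 hcont.continuousOn
    (show K / s ∈ Set.Icc (H 0) (H Y) from ⟨by rw [hH0]; exact hKs.le, hHY⟩)
  have hypos : 0 < y := lt_of_le_of_ne hy0 fun h => by
    rw [← h, hH0] at hy
    exact hKs.ne hy
  refine ⟨y⁻¹, ⟨inv_pos.mpr hypos, (hconv (inv_pos.mpr hypos)).mpr (by rw [inv_inv, hy])⟩, ?_⟩
  rintro x ⟨hx, hxe⟩
  have hx' := (hconv hx).mp hxe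
  rw [← inv_inv x]
  congr 1
  rcases lt_trichotomy x⁻¹ y with h | h | h
  · have := hstrict h (by rw [hx']; exact hKs)
    linarith
  · exact h
  · have := hstrict h (by rw [hy]; exact hKs)
    linarith

section Pinsker

variable {n : ℕ} {G : SimpleGraph (Fin n)} {ψ : Fin n → Fin n → ℝ} {r β Q σ x : ℝ}

theorem existsUnique_isPinskerLevel (hn : 0 < n) (G : SimpleGraph (Fin n)) (r β : ℝ)
    (hQ : 0 < Q) (hσ : 0 < σ) : ∃! x : ℝ, IsPinskerLevel G r β Q σ x := by
  have : Nonempty (Fin n) := ⟨⟨0, hn⟩⟩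
  have hn' : (0 : ℝ) < n := by exact_mod_cast hn
  exact existsUnique_pinsker_level (fun j => zero_lt_one.trans_le (one_le_axisCoeff G r β j))
    (s := (σ / Real.sqrt n) ^ 2) (by positivity) (by positivity)

theorem measurable_pinskerEstimator (G : SimpleGraph (Fin n)) (r β x : ℝ)
    (ψ : Fin n → Fin n → ℝ) : Measurable (pinskerEstimator G r β x ψ) := by
  refine measurable_pi_lambda _ fun i => ?_
  simp only [pinskerEstimator, innerN, Finset.sum_apply, Pi.smul_apply, smul_eq_mul]
  fun_prop

/-- Bias-variance decomposition of the risk of the Pinsker estimator in the sequence model. -/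
theorem risk_pinskerEstimator (hψ : IsEigenbasis G ψ) (hn : 0 < n) (f : Fin n → ℝ) :
    risk σ (pinskerEstimator G r β x ψ) f = ENNReal.ofReal (∑ j,
      (((max (1 - x * axisCoeff G r β j) 0 - 1) * innerN f (ψ j)) ^ 2 +
        σ ^ 2 / n * max (1 - x * axisCoeff G r β j) 0 ^ 2)) := by
  have hn' : (0 : ℝ) < n := by exact_mod_cast hn
  set c : Fin n → ℝ := fun j => max (1 - x * axisCoeff G r β j) 0
  have hexp (y : Fin n → ℝ) : normSqN (pinskerEstimator G r β x ψ y - f) =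
      ∑ j, ((c j - 1) * innerN f (ψ j) + ∑ i, (c j * ψ j i / n) * (y i - f i)) ^ 2 := by
    rw [hψ.normSqN_eq_sum]
    refine Finset.sum_congr rfl fun j _ => ?_
    rw [innerN_sub_left, pinskerEstimator, hψ.innerN_sum_smul]
    have : ∑ i, (c j * ψ j i / n) * (y i - f i) = c j * innerN (y - f) (ψ j) := by
      simp only [innerN, Finset.mul_sum, Pi.sub_apply]
      exact Finset.sum_congr rfl fun i _ => by ring
    rw [this, innerN_sub_left]
    ring
  have hw (j : Fin n) : ∑ i, (c j * ψ j i / n) ^ 2 = c j ^ 2 / n := by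
    have h1 := hψ.1 j j
    rw [if_pos rfl, innerN] at h1
    have : ∑ i, (c j * ψ j i / n) ^ 2 = c j ^ 2 / n * (1 / n * ∑ i, ψ j i * ψ j i) := by
      simp only [Finset.mul_sum]
      exact Finset.sum_congr rfl fun i _ => by field_simp
    rw [this, h1, mul_one]
  simp only [risk, hexp]
  simp_rw [ENNReal.ofReal_sum_of_nonneg fun _ _ => sq_nonneg _]
  rw [lintegral_finsetSum _ fun j _ => by fun_prop, ENNReal.ofReal_sum_of_nonneg]
  · refine Finset.sum_congr rfl fun j _ => ?_
    rw [lintegral_affine_sq, hw]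
    congr 1
    ring
  · intro j _
    positivity

/-- The number of semi-axis coefficients not exceeding `T`. -/
noncomputable def axisCount (G : SimpleGraph (Fin n)) (r β T : ℝ) : ℝ :=
  ((Finset.univ.filter fun j => axisCoeff G r β j ≤ T).card : ℝ)

theorem IsPinskerLevel.sum_eq (hx : IsPinskerLevel G r β Q σ x) (hn : 0 < n) :
    σ ^ 2 / n * ∑ j, axisCoeff G r β j * max (1 - x * axisCoeff G r β j) 0 = x * Q ^ 2 := by
  have h := hx.2
  have hx0 := hx.1
  rw [div_pow, Real.sq_sqrt (by positivity)] at h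
  rw [← h, ← mul_assoc, mul_div_cancel₀ _ hx0.ne']

/-- At the Pinsker level the bound `x ^ 2 * Q ^ 2` on the squared bias and the variance add up to
`ε ^ 2 ∑ j, c j`, where `c j = (1 - x a j)₊` are the weights. The weights with `a j ≤ T` are
at most `1`; the others are at most `a j * c j / T`, whose sum is known from Pinsker's equation. -/
theorem maxRisk_pinskerEstimator_le (hψ : IsEigenbasis G ψ) (hn : 0 < n)
    (hx : IsPinskerLevel G r β Q σ x) {T : ℝ} (hT : 0 < T) :
    maxRisk G r β Q σ (pinskerEstimator G r β x ψ) ≤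
      ENNReal.ofReal (σ ^ 2 / n * axisCount G r β T + x * Q ^ 2 / T) := by
  have hn' : (0 : ℝ) < n := by exact_mod_cast hn
  have hx0 := hx.1
  have hsum := hx.sum_eq hn
  refine iSup₂_le fun f hf => ?_
  rw [hψ.mem_sobolevBall_iff] at hf
  rw [risk_pinskerEstimator hψ hn]
  refine ENNReal.ofReal_le_ofReal ?_
  have ha (j : Fin n) := one_le_axisCoeff G r β j
  have hax (j : Fin n) : 0 < x * axisCoeff G r β j := mul_pos hx0 (by linarith [ha j])
  set a := axisCoeff G r β
  set c : Fin n → ℝ := fun j => max (1 - x * a j) 0 with hc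
  have hc0 (j : Fin n) : 0 ≤ c j := le_max_right _ _
  have hc1 (j : Fin n) : c j ≤ 1 := max_le (by linarith [hax j]) zero_le_one
  have hbias : ∑ j, ((c j - 1) * innerN f (ψ j)) ^ 2 ≤ x * (x * Q ^ 2) := by
    calc _ ≤ ∑ j, x ^ 2 * (a j ^ 2 * innerN f (ψ j) ^ 2) := by
          refine Finset.sum_le_sum fun j _ => ?_
          have h1 : 1 - x * a j ≤ c j := le_max_left _ _
          have h2 : (c j - 1) ^ 2 ≤ (x * a j) ^ 2 :=
            sq_le_sq' (by linarith) (by linarith [hc1 j, hax j])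
          rw [mul_pow, ← mul_assoc, ← mul_pow x]
          exact mul_le_mul_of_nonneg_right h2 (sq_nonneg _)
      _ = x ^ 2 * ∑ j, a j ^ 2 * innerN f (ψ j) ^ 2 := by rw [Finset.mul_sum]
      _ ≤ x ^ 2 * Q ^ 2 := by gcongr
      _ = _ := by ring
  have hcc (j : Fin n) : c j ^ 2 + x * (a j * c j) = c j := by
    rcases le_total (1 - x * a j) 0 with h | h
    · simp [hc, max_eq_right h]
    · simp only [hc, max_eq_left h]; ring
  have hcT (j : Fin n) : c j ≤ (if a j ≤ T then 1 else 0) + a j * c j / T := by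
    have h0 : 0 ≤ a j * c j / T :=
      div_nonneg (mul_nonneg (by linarith [ha j]) (hc0 j)) hT.le
    split_ifs with h
    · linarith [hc1 j]
    · rw [zero_add, le_div_iff₀ hT, mul_comm]
      exact mul_le_mul_of_nonneg_right (not_le.mp h).le (hc0 j)
  have hcount : ∑ j, (if a j ≤ T then (1 : ℝ) else 0) = axisCount G r β T := by
    simp [axisCount, a]
  rw [Finset.sum_add_distrib, ← Finset.mul_sum]
  calc _ ≤ x * (x * Q ^ 2) + σ ^ 2 / n * ∑ j, c j ^ 2 := by gcongr
    _ = σ ^ 2 / n * ∑ j, c j := by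
        rw [← hsum, mul_left_comm, ← mul_add, Finset.mul_sum, ← Finset.sum_add_distrib]
        congr 1
        exact Finset.sum_congr rfl fun j _ => by rw [add_comm]; exact hcc j
    _ ≤ σ ^ 2 / n * ∑ j, ((if a j ≤ T then 1 else 0) + a j * c j / T) := by
        gcongr with j _
        exact hcT j
    _ = _ := by rw [Finset.sum_add_distrib, ← Finset.sum_div, hcount, mul_add,
        ← mul_div_assoc, hsum]

/-- Only the coefficients `a j ≤ 1 / x` contribute to Pinsker's equation, each at most `1 / x`. -/
theorem IsPinskerLevel.sq_le (hx : IsPinskerLevel G r β Q σ x) (hn : 0 < n) :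
    x ^ 2 * Q ^ 2 ≤ σ ^ 2 / n * axisCount G r β x⁻¹ := by
  have hx0 := hx.1
  have hcount : ∑ j, (if axisCoeff G r β j ≤ x⁻¹ then (1 : ℝ) else 0) = axisCount G r β x⁻¹ := by
    simp [axisCount]
  calc x ^ 2 * Q ^ 2 = x * (x * Q ^ 2) := by ring
    _ = σ ^ 2 / n * ∑ j, x * (axisCoeff G r β j * max (1 - x * axisCoeff G r β j) 0) := by
        rw [← hx.sum_eq hn, mul_left_comm, Finset.mul_sum]
    _ ≤ σ ^ 2 / n * ∑ j, (if axisCoeff G r β j ≤ x⁻¹ then (1 : ℝ) else 0) := by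
        gcongr with j _
        have ha := one_le_axisCoeff G r β j
        have hax : 0 < x * axisCoeff G r β j := by positivity
        rw [← mul_assoc]
        split_ifs with h
        · have h1 : x * axisCoeff G r β j ≤ 1 := by
            rw [le_inv_comm₀ (by linarith) hx0] at h
            calc x * axisCoeff G r β j ≤ (axisCoeff G r β j)⁻¹ * axisCoeff G r β j := by gcongr
              _ = 1 := inv_mul_cancel₀ (by linarith)
          have h2 : max (1 - x * axisCoeff G r β j) 0 ≤ 1 := max_le (by linarith) zero_le_one
          exact mul_le_one₀ h1 (le_max_right _ _) h2
        · have h1 : 1 ≤ x * axisCoeff G r β j := by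
            rw [not_le, inv_lt_iff_one_lt_mul₀ hx0] at h
            linarith
          rw [max_eq_right (by linarith), mul_zero]
    _ = _ := by rw [hcount]

end Pinsker

/-! ### Eigenvalue growth and the upper bound -/

section Counting

variable {n : ℕ} {G : SimpleGraph (Fin n)} {r β σ Q : ℝ}

/-- The lower spectral bound at indices up to `κ n` extends to all larger indices, because the
eigenvalues are increasing: compare with the eigenvalue at index `⌊κ n⌋`. -/
theorem le_lapEigenvalue {i₀ : ℕ} {κ C : ℝ} (hr : 0 < r) (hκ : 0 < κ) (hκ1 : κ ≤ 1) (hC : 0 < C)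
    (h : ∀ i : Fin n, i₀ ≤ (i : ℕ) → ((i : ℕ) : ℝ) ≤ κ * n →
      C * (((i : ℕ) : ℝ) / n) ^ (2 / r) ≤ lapEigenvalue G i)
    (hn1 : 1 ≤ κ * n) (hn2 : (i₀ : ℝ) ≤ κ * n) (j : Fin n) (hj : i₀ ≤ (j : ℕ)) :
    C * (κ / 2) ^ (2 / r) * (((j : ℕ) : ℝ) / n) ^ (2 / r) ≤ lapEigenvalue G j := by
  have hn : (0 : ℝ) < n := by
    by_contra hcon
    nlinarith
  have hj0 : (0 : ℝ) ≤ ((j : ℕ) : ℝ) / n := by positivity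
  rcases le_or_gt (((j : ℕ) : ℝ)) (κ * n) with hjκ | hjκ
  · refine le_trans ?_ (h j hj hjκ)
    have : (κ / 2) ^ (2 / r) ≤ 1 := Real.rpow_le_one (by positivity) (by linarith) (by positivity)
    refine mul_le_mul_of_nonneg_right ?_ (by positivity)
    exact mul_le_of_le_one_right hC.le this
  · have hp : ((⌊κ * n⌋₊ : ℕ) : ℝ) ≤ κ * n := Nat.floor_le (by positivity)
    have hpj : ⌊κ * n⌋₊ < (j : ℕ) := by exact_mod_cast hp.trans_lt hjκ
    set p : Fin n := ⟨⌊κ * n⌋₊, hpj.trans j.isLt⟩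
    have hp1 : κ * n / 2 ≤ ((p : ℕ) : ℝ) := by
      have h1 : (1 : ℝ) ≤ ((p : ℕ) : ℝ) := by
        exact_mod_cast Nat.le_floor (by simpa using hn1)
      have h2 : κ * n < ((p : ℕ) : ℝ) + 1 := Nat.lt_floor_add_one _
      linarith
    refine le_trans ?_ ((h p (Nat.le_floor hn2) hp).trans (lapEigenvalue_monotone G hpj.le))
    have hj1 : (((j : ℕ) : ℝ) / n) ^ (2 / r) ≤ 1 :=
      Real.rpow_le_one hj0 (by
        rw [div_le_one hn]
        exact_mod_cast j.isLt.le) (by positivity)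
    calc C * (κ / 2) ^ (2 / r) * (((j : ℕ) : ℝ) / n) ^ (2 / r) ≤ C * (κ / 2) ^ (2 / r) :=
          mul_le_of_le_one_right (by positivity) hj1
      _ ≤ _ := by
          have : κ / 2 ≤ ((p : ℕ) : ℝ) / n := by
            rw [le_div_iff₀ hn]
            linarith
          exact mul_le_mul_of_nonneg_left
            (Real.rpow_le_rpow (by positivity) this (by positivity)) hC.le

/-- Polynomial growth `a j ≳ j ^ (β / r)` of the coefficients, in the form of a count. -/
theorem axisCount_le {i₀ : ℕ} {C T : ℝ} (hr : 0 < r) (hβ : 0 < β) (hC : 0 < C) (hn : 0 < n)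
    (h : ∀ j : Fin n, i₀ ≤ (j : ℕ) → C * (((j : ℕ) : ℝ) / n) ^ (2 / r) ≤ lapEigenvalue G j)
    (hT : 0 < T) :
    axisCount G r β T ≤ (i₀ + 1 + C ^ (-(r / 2))) * T ^ (r / β) := by
  have hn' : (0 : ℝ) < n := by exact_mod_cast hn
  rcases lt_or_ge T 1 with hT1 | hT1
  · have : axisCount G r β T = 0 := by
      rw [axisCount, Finset.filter_eq_empty_iff.mpr fun j _ hj =>
        absurd (one_le_axisCoeff G r β j) (by linarith)]
      simp
    rw [this]
    positivity
  set B := C ^ (-(r / 2)) * T ^ (r / β)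
  have hB : 0 ≤ B := by positivity
  have hsub (j : Fin n) (hj : axisCoeff G r β j ≤ T) : (j : ℕ) < i₀ + ⌊B⌋₊ + 1 := by
    rcases lt_or_ge (j : ℕ) i₀ with hji | hji
    · omega
    have h1 : C * ((j : ℕ) : ℝ) ^ (2 / r) ≤ (n : ℝ) ^ (2 / r) * lapEigenvalue G j := by
      calc C * ((j : ℕ) : ℝ) ^ (2 / r)
          = (n : ℝ) ^ (2 / r) * (C * (((j : ℕ) : ℝ) / n) ^ (2 / r)) := by
            rw [Real.div_rpow (by positivity) hn'.le]
            field_simp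
        _ ≤ _ := by
            gcongr
            exact h j hji
    have h2 : (C * ((j : ℕ) : ℝ) ^ (2 / r)) ^ β ≤ T ^ 2 := by
      calc _ ≤ ((n : ℝ) ^ (2 / r) * lapEigenvalue G j) ^ β := by gcongr
        _ ≤ axisCoeff G r β j ^ 2 := by rw [axisCoeff_sq]; linarith
        _ ≤ T ^ 2 := by
            have := one_le_axisCoeff G r β j
            gcongr
    have h3 : ((j : ℕ) : ℝ) ≤ B := by
      have e : 0 < r / (2 * β) := by positivity
      have h4 := Real.rpow_le_rpow (by positivity) h2 e.le
      have e1 : ((C * ((j : ℕ) : ℝ) ^ (2 / r)) ^ β) ^ (r / (2 * β)) =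
          C ^ (r / 2) * ((j : ℕ) : ℝ) := by
        rw [← Real.rpow_mul (by positivity), Real.mul_rpow hC.le (by positivity),
          ← Real.rpow_mul (by positivity)]
        congr 1
        · congr 1; field_simp
        · rw [show 2 / r * (β * (r / (2 * β))) = 1 by field_simp, Real.rpow_one]
      have e2 : (T ^ 2) ^ (r / (2 * β)) = T ^ (r / β) := by
        rw [← Real.rpow_natCast, ← Real.rpow_mul hT.le]
        congr 1
        push_cast
        field_simp
      rw [e1, e2] at h4
      simp only [B]
      rw [Real.rpow_neg hC.le, ← div_eq_inv_mul, le_div_iff₀ (by positivity), mul_comm]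
      exact h4
    have := Nat.le_floor h3
    omega
  have hcard : (Finset.univ.filter fun j => axisCoeff G r β j ≤ T).card ≤ i₀ + ⌊B⌋₊ + 1 := by
    rw [← Finset.card_range (i₀ + ⌊B⌋₊ + 1)]
    refine Finset.card_le_card_of_injOn (fun j : Fin n => (j : ℕ)) (fun j hj => ?_)
      Fin.val_injective.injOn
    simp only [Finset.coe_filter, Finset.mem_univ, true_and, Set.mem_ofPred_eq] at hj
    simpa using hsub j hj
  have hT' : 1 ≤ T ^ (r / β) := Real.one_le_rpow hT1 (by positivity)
  calc axisCount G r β T ≤ ((i₀ + ⌊B⌋₊ + 1 : ℕ) : ℝ) := by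
        rw [axisCount]
        exact_mod_cast hcard
    _ ≤ i₀ + 1 + B := by
        push_cast
        linarith [Nat.floor_le hB]
    _ ≤ (i₀ + 1) * T ^ (r / β) + B := by
        gcongr
        exact le_mul_of_one_le_right (by positivity) hT'
    _ = _ := by simp only [B]; ring

/-- Upper bound on the Pinsker level and on the maximal risk when the number of coefficients up to
`T` is at most `K * T ^ (r / β)`; the threshold is `T = n ^ (β / (2 β + r))`. -/
theorem maxRisk_pinskerEstimator_le_rate {ψ : Fin n → Fin n → ℝ} {x K : ℝ} (hr : 0 < r)
    (hβ : 0 < β) (hσ : 0 < σ) (hQ : 0 < Q) (hK : 0 ≤ K) (hn : 0 < n) (hψ : IsEigenbasis G ψ)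
    (hx : IsPinskerLevel G r β Q σ x)
    (hcount : ∀ T, 0 < T → axisCount G r β T ≤ K * T ^ (r / β)) :
    maxRisk G r β Q σ (pinskerEstimator G r β x ψ) ≤
      ENNReal.ofReal (σ ^ 2 * K + (σ ^ 2 * K / Q ^ 2) ^ (β / (2 * β + r)) * Q ^ 2) * rate n r β := by
  have hn' : (0 : ℝ) < n := by exact_mod_cast hn
  have hx0 := hx.1
  set γ := β / (2 * β + r) with hγ
  have hγ0 : 0 < γ := by positivity
  have hxle : x ≤ (σ ^ 2 * K / Q ^ 2) ^ γ * (n : ℝ) ^ (-γ) := by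
    have h1 := (hx.sq_le hn).trans
      (mul_le_mul_of_nonneg_left (hcount x⁻¹ (inv_pos.mpr hx0)) (by positivity))
    have h2 : x ^ (γ⁻¹) ≤ σ ^ 2 * K / Q ^ 2 * (n : ℝ)⁻¹ := by
      have e : x ^ (γ⁻¹) = x ^ 2 * x ^ (r / β) := by
        rw [← Real.rpow_natCast x 2, ← Real.rpow_add hx0]
        congr 1
        rw [hγ, inv_div]
        push_cast
        field_simp
      rw [Real.inv_rpow hx0.le] at h1
      have hxp : 0 < x ^ (r / β) := by positivity
      have h3 := mul_le_mul_of_nonneg_right h1 hxp.le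
      have h4 : σ ^ 2 / n * (K * (x ^ (r / β))⁻¹) * x ^ (r / β) = σ ^ 2 * K / n := by
        field_simp
      rw [h4] at h3
      have h5 : σ ^ 2 * K / Q ^ 2 * (n : ℝ)⁻¹ = σ ^ 2 * K / n / Q ^ 2 := by field_simp
      rw [e, h5, le_div_iff₀ (by positivity)]
      linarith
    calc x = (x ^ (γ⁻¹)) ^ γ := by
          rw [← Real.rpow_mul hx0.le, inv_mul_cancel₀ hγ0.ne', Real.rpow_one]
      _ ≤ (σ ^ 2 * K / Q ^ 2 * (n : ℝ)⁻¹) ^ γ := by gcongr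
      _ = _ := by
        rw [Real.mul_rpow (by positivity) (by positivity), Real.inv_rpow hn'.le,
          Real.rpow_neg hn'.le]
  have hT : 0 < (n : ℝ) ^ γ := by positivity
  refine (maxRisk_pinskerEstimator_le hψ hn hx hT).trans ?_
  rw [rate, ← ENNReal.ofReal_mul (by positivity)]
  refine ENNReal.ofReal_le_ofReal ?_
  have hr1 : σ ^ 2 / n * axisCount G r β ((n : ℝ) ^ γ) ≤
      σ ^ 2 * K * (n : ℝ) ^ (-(2 * β) / (2 * β + r)) := by
    calc _ ≤ σ ^ 2 / n * (K * ((n : ℝ) ^ γ) ^ (r / β)) := by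
          gcongr
          exact hcount _ hT
      _ = σ ^ 2 * K * ((n : ℝ) ^ (-1 : ℝ) * ((n : ℝ) ^ γ) ^ (r / β)) := by
          rw [Real.rpow_neg_one]; ring
      _ = _ := by
          rw [← Real.rpow_mul hn'.le, ← Real.rpow_add hn']
          congr 2
          rw [hγ]
          field_simp
          ring
  have hr2 : x * Q ^ 2 / (n : ℝ) ^ γ ≤
      (σ ^ 2 * K / Q ^ 2) ^ γ * Q ^ 2 * (n : ℝ) ^ (-(2 * β) / (2 * β + r)) := by
    calc _ ≤ (σ ^ 2 * K / Q ^ 2) ^ γ * (n : ℝ) ^ (-γ) * Q ^ 2 / (n : ℝ) ^ γ := by gcongr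
      _ = (σ ^ 2 * K / Q ^ 2) ^ γ * Q ^ 2 * ((n : ℝ) ^ (-γ) * (n : ℝ) ^ (-γ)) := by
          rw [Real.rpow_neg hn'.le]; ring
      _ = _ := by
          rw [← Real.rpow_add hn']
          congr 2
          rw [hγ]
          field_simp
          ring
  linarith

end Counting

/-! ### Assouad's lower bound -/

section Assouad

variable {n : ℕ} {G : SimpleGraph (Fin n)} {ψ : Fin n → Fin n → ℝ} {r β Q σ δ : ℝ}

/-- The vertices of a hypercube of signals: the Fourier coefficients are `± δ` for indices in `J`,
with signs given by `θ`, and `0` elsewhere. -/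
noncomputable def cubeSignal (ψ : Fin n → Fin n → ℝ) (J : Finset (Fin n)) (δ : ℝ)
    (θ : Fin n → Bool) : Fin n → ℝ :=
  ∑ j, (if j ∈ J then (if θ j then δ else -δ) else 0) • ψ j

/-- Reversal of the `j`-th sign. -/
def flipSign (j : Fin n) : (Fin n → Bool) ≃ (Fin n → Bool) where
  toFun θ := Function.update θ j (!θ j)
  invFun θ := Function.update θ j (!θ j)
  left_inv θ := by simp
  right_inv θ := by simp

theorem innerN_cubeSignal (hψ : IsEigenbasis G ψ) (J : Finset (Fin n)) (θ : Fin n → Bool)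
    (j : Fin n) : innerN (cubeSignal ψ J δ θ) (ψ j) =
      if j ∈ J then (if θ j then δ else -δ) else 0 :=
  hψ.innerN_sum_smul _ _

theorem cubeSignal_mem_sobolevBall (hψ : IsEigenbasis G ψ) {J : Finset (Fin n)}
    (hJ : ∑ j ∈ J, axisCoeff G r β j ^ 2 * δ ^ 2 ≤ Q ^ 2) (θ : Fin n → Bool) :
    cubeSignal ψ J δ θ ∈ sobolevBall G r β Q := by
  rw [hψ.mem_sobolevBall_iff]
  refine le_of_eq_of_le ?_ hJ
  rw [← Finset.sum_subset (Finset.subset_univ J)]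
  · refine Finset.sum_congr rfl fun j hj => ?_
    rw [innerN_cubeSignal hψ, if_pos hj]
    split_ifs <;> simp
  · intro j _ hj
    rw [innerN_cubeSignal hψ, if_neg hj]
    simp

theorem sum_sq_cubeSignal_sub_flipSign (hψ : IsEigenbasis G ψ) (hn : 0 < n)
    {J : Finset (Fin n)} {j : Fin n} (hj : j ∈ J) (θ : Fin n → Bool) :
    ∑ i, (cubeSignal ψ J δ θ i - cubeSignal ψ J δ (flipSign j θ) i) ^ 2 = n * (4 * δ ^ 2) := by
  have hn' : (n : ℝ) ≠ 0 := by positivity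
  have h := hψ.normSqN_eq_sum (cubeSignal ψ J δ θ - cubeSignal ψ J δ (flipSign j θ))
  rw [Finset.sum_eq_single j] at h
  · simp only [innerN_sub_left, innerN_cubeSignal hψ, if_pos hj] at h
    rw [normSqN] at h
    have h2 : ((if θ j then δ else -δ) - if flipSign j θ j then δ else -δ) ^ 2 = 4 * δ ^ 2 := by
      cases hθ : θ j <;> simp [flipSign, hθ] <;> ring
    rw [h2, one_div, inv_mul_eq_iff_eq_mul₀ hn'] at h
    simpa using h
  · intro l _ hl
    simp only [innerN_sub_left, innerN_cubeSignal hψ]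
    have : flipSign j θ l = θ l := by simp [flipSign, hl]
    rw [this]
    simp
  · simp

/-- **Assouad's lemma** for the hypercube of signals. The average over the hypercube of the risk
in the coordinate `j ∈ J` is estimated by pairing each vertex with its neighbour in direction
`j`. -/
theorem card_mul_le_maxRisk (hψ : IsEigenbasis G ψ) (hn : 0 < n) (hσ : 0 < σ)
    {J : Finset (Fin n)} (hJ : ∑ j ∈ J, axisCoeff G r β j ^ 2 * δ ^ 2 ≤ Q ^ 2)
    (hδ : n * δ ^ 2 ≤ σ ^ 2) {fhat : (Fin n → ℝ) → Fin n → ℝ} (hf : Measurable fhat) :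
    (J.card : ℝ≥0∞) * ENNReal.ofReal (δ ^ 2 / 4) ≤ maxRisk G r β Q σ fhat := by
  set s : Bool → ℝ := fun b => if b then δ else -δ with hs
  have hg (j : Fin n) : Measurable fun y => innerN (fhat y) (ψ j) := by
    unfold innerN
    fun_prop
  set X : Fin n → (Fin n → Bool) → ℝ≥0∞ := fun j θ =>
    ∫⁻ y, .ofReal ((innerN (fhat y) (ψ j) - s (θ j)) ^ 2) ∂(obsLaw σ (cubeSignal ψ J δ θ)) with hX
  have hrisk (θ : Fin n → Bool) : ∑ j ∈ J, X j θ ≤ maxRisk G r β Q σ fhat := by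
    have h1 : risk σ fhat (cubeSignal ψ J δ θ) ≤ maxRisk G r β Q σ fhat :=
      le_iSup₂ (f := fun f _ => risk σ fhat f) _ (cubeSignal_mem_sobolevBall hψ hJ θ)
    refine le_trans ?_ h1
    rw [hX, ← lintegral_finsetSum _ fun j _ => by
      have := hg j
      fun_prop]
    refine lintegral_mono fun y => ?_
    rw [← ENNReal.ofReal_sum_of_nonneg fun _ _ => sq_nonneg _]
    refine ENNReal.ofReal_le_ofReal ?_
    rw [hψ.normSqN_eq_sum]
    calc _ = ∑ j ∈ J, innerN (fhat y - cubeSignal ψ J δ θ) (ψ j) ^ 2 := by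
          refine Finset.sum_congr rfl fun j hj => ?_
          rw [innerN_sub_left, innerN_cubeSignal hψ, if_pos hj]
      _ ≤ _ := Finset.sum_le_sum_of_subset_of_nonneg (Finset.subset_univ _)
          fun _ _ _ => sq_nonneg _
  have hpair (j : Fin n) (hj : j ∈ J) (θ : Fin n → Bool) :
      2 * ENNReal.ofReal (δ ^ 2 / 4) ≤ X j θ + X j (flipSign j θ) := by
    have hA : 1 / 2 ≤ Real.exp (-(∑ i, (cubeSignal ψ J δ θ i -
        cubeSignal ψ J δ (flipSign j θ) i) ^ 2) / (8 * σ ^ 2)) := by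
      rw [sum_sq_cubeSignal_sub_flipSign hψ hn hj]
      have h1 : -(1 / 2) ≤ -((n : ℝ) * (4 * δ ^ 2)) / (8 * σ ^ 2) := by
        rw [le_div_iff₀ (by positivity)]
        linarith
      linarith [Real.add_one_le_exp (-((n : ℝ) * (4 * δ ^ 2)) / (8 * σ ^ 2))]
    refine le_trans (le_of_eq ?_) (two_point_bound hσ _ _ (hg j) (s (θ j))
      (s (flipSign j θ j)) hA)
    have : (s (θ j) - s (flipSign j θ j)) ^ 2 = 4 * δ ^ 2 := by
      cases hθ : θ j <;> simp [hs, flipSign, hθ] <;> ring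
    rw [this, two_mul, ← ENNReal.ofReal_add (by positivity) (by positivity)]
    congr 1
    ring
  have hsum (j : Fin n) (hj : j ∈ J) :
      (2 : ℝ≥0∞) ^ n * ENNReal.ofReal (δ ^ 2 / 4) ≤ ∑ θ, X j θ := by
    have h1 : ∑ _θ : Fin n → Bool, 2 * ENNReal.ofReal (δ ^ 2 / 4) ≤
        ∑ θ, (X j θ + X j (flipSign j θ)) := Finset.sum_le_sum fun θ _ => hpair j hj θ
    rw [Finset.sum_add_distrib, (flipSign j).sum_comp (X j), ← two_mul, Finset.sum_const,
      Finset.card_univ, nsmul_eq_mul, mul_left_comm] at h1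
    simpa using (ENNReal.mul_le_mul_iff_right (by norm_num) (by norm_num)).mp h1
  have htot : (2 : ℝ≥0∞) ^ n * ((J.card : ℝ≥0∞) * ENNReal.ofReal (δ ^ 2 / 4)) ≤
      (2 : ℝ≥0∞) ^ n * maxRisk G r β Q σ fhat := by
    calc _ = ∑ j ∈ J, (2 : ℝ≥0∞) ^ n * ENNReal.ofReal (δ ^ 2 / 4) := by
          rw [Finset.sum_const, nsmul_eq_mul, mul_left_comm]
      _ ≤ ∑ j ∈ J, ∑ θ, X j θ := Finset.sum_le_sum hsum
      _ = ∑ θ, ∑ j ∈ J, X j θ := Finset.sum_comm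
      _ ≤ ∑ _θ : Fin n → Bool, maxRisk G r β Q σ fhat := Finset.sum_le_sum fun θ _ => hrisk θ
      _ = _ := by simp
  exact (ENNReal.mul_le_mul_iff_right (by positivity) (by finiteness)).mp htot

/-- Lower bound from the frequencies `i₀ ≤ j ≤ m` with `m = ⌊n ^ (r / (2 β + r))⌋` and
amplitude `δ ^ 2 = c / n`. -/
theorem rate_le_maxRisk {i₀ : ℕ} {κ C c : ℝ} (hr : 0 < r) (hβ : 0 < β)
    (hσ : 0 < σ) (hC : 0 < C) (hc : 0 < c) (hcσ : c ≤ σ ^ 2) (hcQ : 2 * (1 + C ^ β) * c ≤ Q ^ 2)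
    (h : ∀ i : Fin n, i₀ ≤ (i : ℕ) → ((i : ℕ) : ℝ) ≤ κ * n →
      lapEigenvalue G i ≤ C * (((i : ℕ) : ℝ) / n) ^ (2 / r))
    (hn : 0 < n) (hn1 : 2 * (i₀ : ℝ) + 1 ≤ (n : ℝ) ^ (r / (2 * β + r)))
    (hn2 : (n : ℝ) ^ (r / (2 * β + r)) < n) (hn3 : (n : ℝ) ^ (r / (2 * β + r)) ≤ κ * n)
    {fhat : (Fin n → ℝ) → Fin n → ℝ} (hf : Measurable fhat) :
    ENNReal.ofReal (c / 16) * rate n r β ≤ maxRisk G r β Q σ fhat := by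
  obtain ⟨ψ, hψ⟩ := exists_isEigenbasis hn G
  have hn' : (0 : ℝ) < n := by exact_mod_cast hn
  set α := r / (2 * β + r) with hα
  have hN0 : 0 ≤ (n : ℝ) ^ α := by positivity
  set m := ⌊(n : ℝ) ^ α⌋₊
  have hmle : (m : ℝ) ≤ (n : ℝ) ^ α := Nat.floor_le hN0
  have hmlt : (n : ℝ) ^ α < m + 1 := Nat.lt_floor_add_one _
  have hmi : 2 * i₀ + 1 ≤ m := Nat.le_floor (by push_cast; exact hn1)
  have hmi' : 2 * (i₀ : ℝ) + 1 ≤ m := by exact_mod_cast hmi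
  have hmn : m < n := by exact_mod_cast hmle.trans_lt hn2
  have hm1 : (1 : ℝ) ≤ m := by
    have : (0 : ℝ) ≤ i₀ := by positivity
    linarith
  set J : Finset (Fin n) := Finset.Icc ⟨i₀, by omega⟩ ⟨m, hmn⟩ with hJ
  have hcard : (J.card : ℝ) = m + 1 - i₀ := by
    rw [hJ, Fin.card_Icc, Nat.cast_sub (by simp only; omega)]
    push_cast
    ring
  set δ := Real.sqrt (c / n)
  have hδ : δ ^ 2 = c / n := Real.sq_sqrt (by positivity)
  have hax (j : Fin n) (hj : j ∈ J) :
      axisCoeff G r β j ^ 2 ≤ (1 + C ^ β) * (m : ℝ) ^ (2 * β / r) := by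
    rw [hJ, Finset.mem_Icc, Fin.le_def, Fin.le_def] at hj
    have hjm : ((j : ℕ) : ℝ) ≤ m := by exact_mod_cast hj.2
    have h1 := h j hj.1 (hjm.trans (hmle.trans hn3))
    have h2 : (n : ℝ) ^ (2 / r) * lapEigenvalue G j ≤ C * (m : ℝ) ^ (2 / r) := by
      calc _ ≤ (n : ℝ) ^ (2 / r) * (C * (((j : ℕ) : ℝ) / n) ^ (2 / r)) := by gcongr
        _ = C * ((j : ℕ) : ℝ) ^ (2 / r) := by
            rw [Real.div_rpow (by positivity) hn'.le]
            field_simp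
        _ ≤ _ := by gcongr
    have h0 := lapEigenvalue_nonneg G j
    rw [axisCoeff_sq]
    calc _ ≤ 1 + (C * (m : ℝ) ^ (2 / r)) ^ β := by gcongr
      _ = 1 + C ^ β * (m : ℝ) ^ (2 * β / r) := by
          rw [Real.mul_rpow hC.le (by positivity), ← Real.rpow_mul (by positivity)]
          congr 3
          ring
      _ ≤ (m : ℝ) ^ (2 * β / r) + C ^ β * (m : ℝ) ^ (2 * β / r) := by
          gcongr
          exact Real.one_le_rpow hm1 (by positivity)
      _ = _ := by ring
  have hball : ∑ j ∈ J, axisCoeff G r β j ^ 2 * δ ^ 2 ≤ Q ^ 2 := by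
    have hmp : (m : ℝ) * (m : ℝ) ^ (2 * β / r) ≤ n := by
      calc (m : ℝ) * (m : ℝ) ^ (2 * β / r) = (m : ℝ) ^ (1 + 2 * β / r) := by
            rw [Real.rpow_add (by positivity), Real.rpow_one]
        _ ≤ ((n : ℝ) ^ α) ^ (1 + 2 * β / r) := by gcongr
        _ = n := by
            rw [← Real.rpow_mul hn'.le, hα,
              show r / (2 * β + r) * (1 + 2 * β / r) = 1 by field_simp; ring, Real.rpow_one]
    have hi₀ : (0 : ℝ) ≤ i₀ := by positivity
    calc _ ≤ ∑ j ∈ J, (1 + C ^ β) * (m : ℝ) ^ (2 * β / r) * (c / n) := by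
          rw [hδ]
          gcongr with j hj
          exact hax j hj
      _ = (J.card : ℝ) * ((1 + C ^ β) * (m : ℝ) ^ (2 * β / r) * (c / n)) := by
          rw [Finset.sum_const, nsmul_eq_mul]
      _ ≤ (2 * m) * ((1 + C ^ β) * (m : ℝ) ^ (2 * β / r) * (c / n)) := by
          gcongr
          rw [hcard]
          linarith
      _ = 2 * (1 + C ^ β) * c * ((m : ℝ) * (m : ℝ) ^ (2 * β / r) / n) := by ring
      _ ≤ 2 * (1 + C ^ β) * c * 1 := by
          gcongr
          rwa [div_le_one hn']
      _ ≤ Q ^ 2 := by rwa [mul_one]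
  refine le_trans ?_ (card_mul_le_maxRisk hψ hn hσ hball (by
    rw [hδ, mul_div_cancel₀ _ hn'.ne']; exact hcσ) hf)
  rw [rate, ← ENNReal.ofReal_natCast, ← ENNReal.ofReal_mul (by positivity),
    ← ENNReal.ofReal_mul (by positivity)]
  refine ENNReal.ofReal_le_ofReal ?_
  have hrate : (n : ℝ) ^ (-(2 * β) / (2 * β + r)) = (n : ℝ) ^ α / n := by
    rw [← Real.rpow_sub_one hn'.ne']
    congr 1
    rw [hα]
    field_simp
    ring
  have hcard4 : (n : ℝ) ^ α / 4 ≤ J.card := by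
    rw [hcard]
    linarith
  rw [hrate, hδ]
  calc c / 16 * ((n : ℝ) ^ α / n) = (n : ℝ) ^ α / 4 * (c / n / 4) := by ring
    _ ≤ _ := by gcongr

end Assouad

theorem SameOrder.of_eventually_le {n : ℕ → ℕ} (hn : Tendsto n atTop atTop) {r β c C : ℝ}
    (hc : 0 < c) {a : ℕ → ℝ≥0∞}
    (hlo : ∀ᶠ k in atTop, ENNReal.ofReal c * rate (n k) r β ≤ a k)
    (hup : ∀ᶠ k in atTop, a k ≤ ENNReal.ofReal C * rate (n k) r β) :
    SameOrder a (fun k => rate (n k) r β) := by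
  have hrate : ∀ᶠ k in atTop, rate (n k) r β ≠ 0 ∧ rate (n k) r β ≠ ∞ := by
    filter_upwards [hn.eventually_gt_atTop 0] with k hk
    have : (0 : ℝ) < n k := by exact_mod_cast hk
    exact ⟨(ENNReal.ofReal_pos.mpr (by positivity)).ne', ENNReal.ofReal_ne_top⟩
  refine ⟨(ENNReal.ofReal_pos.mpr hc).trans_le ?_, liminf_le_limsup,
    lt_of_le_of_lt ?_ (ENNReal.ofReal_lt_top (r := C))⟩
  · refine le_liminf_of_le (by isBoundedDefault) ?_
    filter_upwards [hlo, hrate] with k hk hk'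
    rwa [ENNReal.le_div_iff_mul_le (.inl hk'.1) (.inl hk'.2)]
  · refine limsup_le_of_le (by isBoundedDefault) ?_
    filter_upwards [hup, hrate] with k hk hk'
    rwa [ENNReal.div_le_iff hk'.1 hk'.2]

section Sequence

variable {r σ β Q : ℝ} {n : ℕ → ℕ} {G : ∀ k, SimpleGraph (Fin (n k))}

theorem exists_rate_le_maxRisk (hr : 0 < r) (hn : Tendsto n atTop atTop)
    (hgeo : GeometryAssumption n G r) (hσ : 0 < σ) (hβ : 0 < β) (hQ : 0 < Q) :
    ∃ c : ℝ, 0 < c ∧ ∀ᶠ k in atTop, ∀ fhat : (Fin (n k) → ℝ) → Fin (n k) → ℝ, Measurable fhat →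
      ENNReal.ofReal c * rate (n k) r β ≤ maxRisk (G k) r β Q σ fhat := by
  obtain ⟨i₀, κ, C₁, C₂, hκ, hκ1, hC₁, hC₂, h⟩ := hgeo
  have hα0 : 0 < r / (2 * β + r) := by positivity
  have hα1 : r / (2 * β + r) < 1 := by
    rw [div_lt_one (by positivity)]
    linarith
  have hnR : Tendsto (fun k => (n k : ℝ)) atTop atTop := tendsto_natCast_atTop_atTop.comp hn
  have hlarge : ∀ᶠ k in atTop, 2 * (i₀ : ℝ) + 1 ≤ (n k : ℝ) ^ (r / (2 * β + r)) :=
    ((tendsto_rpow_atTop hα0).comp hnR).eventually_ge_atTop _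
  have hsmall : ∀ᶠ k in atTop, (n k : ℝ) ^ (r / (2 * β + r)) < κ * n k := by
    have ht : Tendsto (fun k => (n k : ℝ) ^ (1 - r / (2 * β + r))) atTop atTop :=
      (tendsto_rpow_atTop (by linarith)).comp hnR
    filter_upwards [ht.eventually_gt_atTop κ⁻¹, hn.eventually_gt_atTop 0] with k hk hk0
    have hk0' : (0 : ℝ) < n k := by exact_mod_cast hk0
    have hp : 0 < (n k : ℝ) ^ (r / (2 * β + r)) := by positivity
    rw [inv_lt_iff_one_lt_mul₀ hκ] at hk
    calc _ < (n k : ℝ) ^ (r / (2 * β + r)) *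
          ((n k : ℝ) ^ (1 - r / (2 * β + r)) * κ) := lt_mul_of_one_lt_right hp (by linarith)
      _ = κ * ((n k : ℝ) ^ (r / (2 * β + r)) * (n k : ℝ) ^ (1 - r / (2 * β + r))) := by ring
      _ = κ * n k := by rw [← Real.rpow_add hk0', add_sub_cancel, Real.rpow_one]
  -- The first bound on `c` keeps the Hellinger affinities above `1 / 2`, the second keeps the
  -- hypercube in the ball.
  set c := min (σ ^ 2) (Q ^ 2 / (2 * (1 + C₂ ^ β)))
  have hden : 0 < 2 * (1 + C₂ ^ β) := by positivity
  have hc : 0 < c := lt_min (by positivity) (by positivity)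
  refine ⟨c / 16, by positivity, ?_⟩
  filter_upwards [h, hlarge, hsmall, hn.eventually_gt_atTop 0] with k hk h1 h2 h3 fhat hf
  have hcQ : 2 * (1 + C₂ ^ β) * c ≤ Q ^ 2 := by
    rw [mul_comm, ← le_div_iff₀ hden]
    exact min_le_right _ _
  refine rate_le_maxRisk hr hβ hσ hC₂ hc (min_le_left _ _) hcQ
    (fun i hi hi' => (hk i hi hi').2) h3 h1 (h2.trans_le ?_) h2.le hf
  exact mul_le_of_le_one_left (by positivity) hκ1

theorem exists_maxRisk_pinskerEstimator_le_rate (hr : 0 < r) (hn : Tendsto n atTop atTop)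
    (hgeo : GeometryAssumption n G r) (hσ : 0 < σ) (hβ : 0 < β) (hQ : 0 < Q) :
    ∃ C : ℝ, ∀ᶠ k in atTop, ∀ (x : ℝ) (ψ : Fin (n k) → Fin (n k) → ℝ),
      IsPinskerLevel (G k) r β Q σ x → IsEigenbasis (G k) ψ →
      maxRisk (G k) r β Q σ (pinskerEstimator (G k) r β x ψ) ≤
        ENNReal.ofReal C * rate (n k) r β := by
  obtain ⟨i₀, κ, C₁, C₂, hκ, hκ1, hC₁, hC₂, h⟩ := hgeo
  have hnR : Tendsto (fun k => κ * (n k : ℝ)) atTop atTop :=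
    (tendsto_natCast_atTop_atTop.comp hn).const_mul_atTop hκ
  set C := C₁ * (κ / 2) ^ (2 / r)
  have hC : 0 < C := by positivity
  set K := (i₀ : ℝ) + 1 + C ^ (-(r / 2))
  refine ⟨σ ^ 2 * K + (σ ^ 2 * K / Q ^ 2) ^ (β / (2 * β + r)) * Q ^ 2, ?_⟩
  filter_upwards [h, hnR.eventually_ge_atTop 1, hnR.eventually_ge_atTop (i₀ : ℝ),
    hn.eventually_gt_atTop 0] with k hk h1 h2 h3 x ψ hx hψ
  refine maxRisk_pinskerEstimator_le_rate hr hβ hσ hQ (by positivity) h3 hψ hx fun T hT => ?_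
  exact axisCount_le hr hβ hC h3
    (le_lapEigenvalue hr hκ hκ1 hC₁ (fun i hi hi' => (hk i hi hi').1) h1 h2) hT

end Sequence

end GraphRegression

theorem theorem1 (r : ℝ) (hr : 1 ≤ r)
    (n : ℕ → ℕ) (hn : Tendsto n atTop atTop)
    (G : ∀ k, SimpleGraph (Fin (n k))) (hG : ∀ k, (G k).Connected)
    (hgeo : GraphRegression.GeometryAssumption n G r)
    (σ : ℝ) (hσ : 0 < σ) (β Q : ℝ) (hβ : 0 < β) (hQ : 0 < Q) :
    GraphRegression.SameOrder
      (fun k => GraphRegression.minimaxRisk (G k) r β Q σ)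
      (fun k => GraphRegression.rate (n k) r β) ∧
    (∀ k, ∃! x : ℝ, GraphRegression.IsPinskerLevel (G k) r β Q σ x) ∧
    ∀ (x : ℕ → ℝ) (ψ : ∀ k, Fin (n k) → Fin (n k) → ℝ),
      (∀ k, GraphRegression.IsPinskerLevel (G k) r β Q σ (x k)) →
      (∀ k, GraphRegression.IsEigenbasis (G k) (ψ k)) →
      GraphRegression.SameOrder
        (fun k => GraphRegression.maxRisk (G k) r β Q σ
          (GraphRegression.pinskerEstimator (G k) r β (x k) (ψ k)))
        (fun k => GraphRegression.rate (n k) r β) := by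
  have hr0 : 0 < r := by linarith
  have hpos (k : ℕ) : 0 < n k := Fin.pos_iff_nonempty.mpr (hG k).nonempty
  have hlevel (k : ℕ) := GraphRegression.existsUnique_isPinskerLevel (hpos k) (G k) r β hQ hσ
  obtain ⟨c, hc, hlow⟩ := GraphRegression.exists_rate_le_maxRisk hr0 hn hgeo hσ hβ hQ
  obtain ⟨C, hup⟩ :=
    GraphRegression.exists_maxRisk_pinskerEstimator_le_rate hr0 hn hgeo hσ hβ hQ
  refine ⟨.of_eventually_le hn hc (C := C) ?_ ?_, hlevel, fun x ψ hx hψ =>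
    .of_eventually_le hn hc (C := C) ?_ ?_⟩
  · filter_upwards [hlow] with k hk
    exact le_iInf₂ hk
  · filter_upwards [hup] with k hk
    obtain ⟨x, hx, -⟩ := hlevel k
    obtain ⟨ψ, hψ⟩ := GraphRegression.exists_isEigenbasis (hpos k) (G k)
    exact (iInf₂_le _ (GraphRegression.measurable_pinskerEstimator (G k) r β x ψ)).trans
      (hk x ψ hx hψ)
  · filter_upwards [hlow] with k hk
    exact hk _ (GraphRegression.measurable_pinskerEstimator (G k) r β (x k) (ψ k))
  · filter_upwards [hup] with k hk
    exact hk _ _ (hx k) (hψ k)
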